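/- Let $\alpha\in(0,\tfrac12)$ be irrational with continued fraction expansion $\alpha=[0;a_1,a_2,\ldots]$, and let $q_0=1$, $q_1=a_1$, $q_k=a_kq_{k-1}+q_{k-2}$ be the denominators of its convergents. Put $\mathcal M_\alpha=\{tq_k : k\ge 0,\ 1\le t\le a_{k+1}\}$. A Sturmian word of slope $\alpha$ is an infinite binary word whose $n$th letter ($n\ge 0$) is $0$ if $\{\rho+n\alpha\}\in I_0$ and $1$ if $\{\rho+n\alpha\}\in I_1$, for some intercept $\rho\in[0,1)$, where either $I_0=[0,1-\alpha)$, $I_1=[1-\alpha,1)$, or $I_0=(0,1-\alpha]$, $I_1=(1-\alpha,1]$ (with the points $0$ and $1$ of the circle identified). A factor of slope $\alpha$ is a finite factor of a Sturmian word of slope $\alpha$. The Parikh vector of a finite binary word $u$ is $(|u|_0,|u|_1)$, the numbers of its letters $0$ and $1$. A word $w$ has abelian period $m$ if $w=u_0u_1\cdots u_{n-1}u_n$ with $n\ge 2$, where $u_1,\ldots,u_{n-1}$ have length $m$ and a common Parikh vector $\mathcal P$, and the Parikh vectors of $u_0$ and $u_n$ are componentwise at most $\mathcal P$ and different from $\mathcal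 P$. If $u_0$ and $u_n$ are empty and $n-1\ge 2$, then $w$ is an abelian power of period $m$ and exponent $n-1$. Let $\mathrm{abexp}(m)$ be the maximum exponent of an abelian power of period $m$ that is a factor of slope $\alpha$. Proposition. Let $w$ be a factor of slope $\alpha$ with minimum abelian period $m$, and suppose that $m\notin\mathcal M_\alpha$. Let $k$ be the largest integer such that $q_k\le m$, and let $t$ be the largest integer such that $1\le t\le a_{k+1}$ and $tq_k\le m$. Then $$(q_{k+1}+2t-1)q_k-q_{k+1}\le |w|,$$ the maximum $\mathrm{abexp}(m)$ exists, and $$(q_{k+1}+2t-1)q_k-q_{k+1}\le(\mathrm{abexp}(m)+2)m-2.$$ -/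

import Mathlib

namespace Sturmian

/-- Finite binary words. -/
abbrev Word : Type := List (Fin 2)

/-! ### Continued fractions -/

/-- The partial quotient `a_n` (`n ≥ 1`) of the continued fraction expansion
`α = [a_0; a_1, a_2, …]`. Mathlib lists `a_1, a_2, …` with indices starting from `0`.
The default value `0` is never used for irrational `α`. -/
noncomputable def partQuot (α : ℝ) (n : ℕ) : ℝ :=
  ((GenContFract.of α).partDens.get? (n - 1)).getD 0

/-- The denominator `q_k` of the `k`-th convergent of `α`, so that `q_0 = 1`, `q_1 = a_1` and
`q_k = a_k q_{k-1} + q_{k-2}`. -/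
noncomputable def convDen (α : ℝ) (k : ℕ) : ℝ :=
  (GenContFract.of α).dens k

/-- The set `M_α = {t q_k : k ≥ 0, 1 ≤ t ≤ a_{k+1}}`. -/
def multSet (α : ℝ) : Set ℕ :=
  {m | ∃ k t : ℕ, 1 ≤ t ∧ (t : ℝ) ≤ partQuot α (k + 1) ∧ (m : ℝ) = t * convDen α k}

/-! ### Sturmian words -/

open Classical in
/-- The Sturmian word of slope `α` and intercept `ρ` for the choice
`I_0 = [0, 1 - α)`, `I_1 = [1 - α, 1)`. The point `{ρ + n α}` is the image of `ρ` under
`n` rotations by `α` on the circle `[0, 1)`. -/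
noncomputable def lowerWord (α ρ : ℝ) (n : ℕ) : Fin 2 :=
  if Int.fract (ρ + n * α) < 1 - α then 0 else 1

open Classical in
/-- The Sturmian word of slope `α` and intercept `ρ` for the choice
`I_0 = (0, 1 - α]`, `I_1 = (1 - α, 1]`, where the point `1` is the point `0` of the circle. -/
noncomputable def upperWord (α ρ : ℝ) (n : ℕ) : Fin 2 :=
  if 0 < Int.fract (ρ + n * α) ∧ Int.fract (ρ + n * α) ≤ 1 - α then 0 else 1

/-- The Sturmian subshift: all Sturmian words of slope `α`. -/
def subshift (α : ℝ) : Set (ℕ → Fin 2) :=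
  {s | ∃ ρ ∈ Set.Ico (0 : ℝ) 1, s = lowerWord α ρ ∨ s = upperWord α ρ}

/-- The factors of slope `α`: all finite factors of the Sturmian words of slope `α`. -/
def lang (α : ℝ) : Set Word :=
  {w | ∃ s ∈ subshift α, ∃ i : ℕ, w = (List.range w.length).map (fun j => s (i + j))}

/-! ### Abelian periods and abelian powers -/

/-- The Parikh vector `(|w|_0, |w|_1)`. -/
def parikh (w : Word) : ℕ × ℕ := (w.count 0, w.count 1)

/-- `w = h · B_1 ⋯ B_r · t` is an abelian decomposition of period `m`: there is at least one
block, all blocks have length `m` and a common Parikh vector `P`, and the Parikh vectors of the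
head `h` and of the tail `t` are contained in `P`, that is, they are componentwise at most `P`
and different from `P` (this is the strict order of `ℕ × ℕ`). -/
def IsAbelianDecomp (w h : Word) (B : List Word) (t : Word) (m : ℕ) : Prop :=
  w = h ++ B.flatten ++ t ∧ B ≠ [] ∧
    ∃ P : ℕ × ℕ, (∀ u ∈ B, u.length = m ∧ parikh u = P) ∧ parikh h < P ∧ parikh t < P

/-- `m` is an abelian period of `w`. -/
def IsAbelianPeriod (w : Word) (m : ℕ) : Prop :=
  ∃ (h : Word) (B : List Word) (t : Word), IsAbelianDecomp w h B t m

/-- `m` is the minimum abelian period of `w`. -/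
def IsMinAbelianPeriod (w : Word) (m : ℕ) : Prop :=
  IsLeast {n | IsAbelianPeriod w n} m

/-- `w` is a (nondegenerate) abelian power of period `m` and exponent `e`: a decomposition with
empty head and tail into `e ≥ 2` blocks. -/
def IsAbelianPower (w : Word) (m e : ℕ) : Prop :=
  2 ≤ e ∧ ∃ B : List Word, B.length = e ∧ IsAbelianDecomp w [] B [] m

/-- The exponents of the abelian powers of period `m` occurring in Sturmian words of slope `α`. -/
def powerExponents (α : ℝ) (m : ℕ) : Set ℕ :=
  {e | ∃ w ∈ lang α, IsAbelianPower w m e}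

/-- The maximum exponent of an abelian power of period `m` occurring in a Sturmian word of
slope `α`. -/
noncomputable def abexp (α : ℝ) (m : ℕ) : ℕ := sSup (powerExponents α m)

end Sturmian

namespace Sturmian

/-! Write `q`, `Q` for the consecutive denominators `q_k`, `q_{k+1}`, with numerators `p`, `P`, and
let `F` be an integer function whose successive differences are the letters, so that `F` counts the
`1`s. Such an `F`, a floor or ceiling of a line of slope `α`, has increments within distance `1` of
linear ones. Over `q` steps it increases by `p`, except at exceptional positions, where the
increment is off by one in the direction given by the sign of `qα - p`.

Exceptional positions are sparse: the vector joining two of them in the graph of `F` has coordinates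
`s ≥ 1`, `u ≥ 0` in the unimodular basis `(Q, P)`, `(q, p)` (`IsBalanced.exists_eq_add`). Since `q`
and `Q` are coprime, two of them in one residue class mod `q` have `s` divisible by `q`. A word
shorter than the claimed bound therefore contains a long run of regular blocks of length `q`, and
grouping these gives an abelian period `sq` with `1 ≤ s ≤ t` (`exists_hasDecomp`,
`exists_isAbelianPeriod`). As `m ∉ M_α`, this period is smaller than `m`, against minimality.

The second inequality follows because `w` has at most `abexp(m)` full blocks, and a head and a tail
of at most `m - 1` letters each. -/

/-! ### Continued fraction convergents and their errors -/

/-- The state of the continued fraction algorithm for `α` after `n` steps: the complete quotient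
has fractional part `x`, and the last two continuants are `(p', q')` and `(p, q)`. -/
structure ConvergentState (α : ℝ) (n : ℕ) (x : ℝ) (p' q' p q : ℤ) : Prop where
  stream : ∃ b, GenContFract.IntFractPair.stream α n = some ⟨b, x⟩
  irr : Irrational x
  pos : 0 < x
  lt_one : x < 1
  prev : (GenContFract.of α).contsAux n = ⟨(p' : ℝ), (q' : ℝ)⟩
  cur : (GenContFract.of α).contsAux (n + 1) = ⟨(p : ℝ), (q : ℝ)⟩
  error : (q : ℝ) * α - p = -x * (q' * α - p')
  det : q * p' - q' * p = 1 ∨ q * p' - q' * p = -1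
  prev_nonneg : 0 ≤ q'
  one_le : 1 ≤ q
  prev_error_le : 1 ≤ n → |(q' : ℝ) * α - p'| ≤ α
  error_le : |(q : ℝ) * α - p| ≤ α
  two_le : 1 ≤ n → 2 ≤ q

theorem ConvergentState.zero {α : ℝ} (hα : Irrational α) (hα0 : 0 < α) (hα1 : α < 1 / 2) :
    ConvergentState α 0 α 1 0 0 1 := by
  have hfl : ⌊α⌋ = 0 := Int.floor_eq_zero_iff.2 ⟨hα0.le, by linarith⟩
  refine ⟨⟨0, ?_⟩, hα, hα0, by linarith, ?_, ?_, ?_, ?_, ?_, ?_, ?_, ?_, ?_⟩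
  · simp [GenContFract.IntFractPair.stream_zero, GenContFract.IntFractPair.of, Int.fract, hfl]
  · simp [GenContFract.zeroth_contAux_eq_one_zero]
  · simp [GenContFract.first_contAux_eq_h_one, hfl]
  all_goals simp
  exact (abs_of_pos hα0).le

theorem ConvergentState.quot_pos {α : ℝ} {n : ℕ} {x : ℝ} {p' q' p q : ℤ}
    (h : ConvergentState α n x p' q' p q) : 1 ≤ ⌊x⁻¹⌋ :=
  Int.le_floor.2 (by push_cast; exact (one_le_inv₀ h.pos).2 h.lt_one.le)

theorem ConvergentState.get?_eq {α : ℝ} {n : ℕ} {x : ℝ} {p' q' p q : ℤ}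
    (h : ConvergentState α n x p' q' p q) :
    (GenContFract.of α).s.get? n = some ⟨1, (⌊x⁻¹⌋ : ℝ)⟩ := by
  obtain ⟨b, hb⟩ := h.stream
  exact GenContFract.get?_of_eq_some_of_get?_intFractPair_stream_fr_ne_zero hb h.pos.ne'

theorem ConvergentState.partQuot_eq {α : ℝ} {n : ℕ} {x : ℝ} {p' q' p q : ℤ}
    (h : ConvergentState α n x p' q' p q) : partQuot α (n + 1) = (⌊x⁻¹⌋ : ℝ) := by
  simp [partQuot, GenContFract.partDen_eq_s_b h.get?_eq]

theorem ConvergentState.convDen_eq {α : ℝ} {n : ℕ} {x : ℝ} {p' q' p q : ℤ}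
    (h : ConvergentState α n x p' q' p q) : convDen α n = (q : ℝ) := by
  simp [convDen, GenContFract.den_eq_conts_b, GenContFract.nth_cont_eq_succ_nth_contAux, h.cur]

theorem ConvergentState.succ {α : ℝ} (hα0 : 0 < α) (hα1 : α < 1 / 2)
    {n : ℕ} {x : ℝ} {p' q' p q : ℤ} (h : ConvergentState α n x p' q' p q)
    (hx : n = 0 → x = α) :
    ConvergentState α (n + 1) (Int.fract x⁻¹) p q (⌊x⁻¹⌋ * p + p') (⌊x⁻¹⌋ * q + q') := by
  have hirr : Irrational (Int.fract x⁻¹) := by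
    unfold Int.fract
    exact (irrational_inv_iff.2 h.irr).sub_intCast _
  have ha := h.quot_pos
  have herr : ((⌊x⁻¹⌋ * q + q' : ℤ) : ℝ) * α - (⌊x⁻¹⌋ * p + p' : ℤ)
      = -Int.fract x⁻¹ * (q * α - p) := by
    have hx0 := h.pos.ne'
    have h2 : (q' : ℝ) * α - p' = -x⁻¹ * (q * α - p) := by
      rw [h.error]; field_simp
    unfold Int.fract
    push_cast
    linear_combination h2
  refine ⟨?_, hirr, ?_, Int.fract_lt_one _, h.cur, ?_, herr, ?_, by linarith [h.one_le], ?_,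
    fun _ => h.error_le, ?_, fun _ => ?_⟩
  · obtain ⟨b, hb⟩ := h.stream
    exact ⟨_, GenContFract.IntFractPair.stream_succ_of_some hb h.pos.ne'⟩
  · exact lt_of_le_of_ne (Int.fract_nonneg _) hirr.ne_zero.symm
  · rw [GenContFract.contsAux_recurrence h.get?_eq h.prev h.cur]
    push_cast
    simp
  · have := h.det
    grind
  · nlinarith [h.one_le, h.prev_nonneg]
  · rw [herr, abs_mul, abs_neg, abs_of_nonneg (Int.fract_nonneg _)]
    exact (mul_le_of_le_one_left (abs_nonneg _) (Int.fract_lt_one _).le).trans h.error_le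
  · rcases Nat.eq_zero_or_pos n with rfl | hn
    -- The first partial quotient is at least `2` because `α < 1/2`.
    · have : (2 : ℤ) ≤ ⌊x⁻¹⌋ := by
        rw [hx rfl]
        refine Int.le_floor.2 ?_
        rw [le_inv_comm₀ (by norm_num) hα0]
        push_cast
        linarith
      nlinarith [h.one_le, h.prev_nonneg]
    · nlinarith [h.two_le hn, h.prev_nonneg]

theorem exists_convergentState {α : ℝ} (hα : Irrational α) (hα0 : 0 < α) (hα1 : α < 1 / 2)
    (n : ℕ) : ∃ x p' q' p q, ConvergentState α n x p' q' p q ∧ (n = 0 → x = α) := by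
  induction n with
  | zero => exact ⟨_, _, _, _, _, .zero hα hα0 hα1, fun _ => rfl⟩
  | succ n ih =>
    obtain ⟨x, p', q', p, q, h, hx⟩ := ih
    exact ⟨_, _, _, _, _, h.succ hα0 hα1 hx, by simp⟩

/-- Two consecutive convergents `p / q` and `P / Q` of `α`. -/
structure IsConvergentPair (α : ℝ) (a q Q : ℕ) (p P : ℤ) : Prop where
  one_le : 1 ≤ a
  two_le : 2 ≤ q
  det : (Q : ℤ) * p - q * P = 1 ∨ (Q : ℤ) * p - q * P = -1
  mul_le : a * q ≤ Q
  sign : ((q : ℝ) * α - p) * (Q * α - P) < 0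
  lt : |(Q : ℝ) * α - P| < |(q : ℝ) * α - p|
  error_le : a * |(q : ℝ) * α - p| ≤ α

/-- The restriction `k ≥ 1` serves `error_le`: `a_{k+1}` times the `k`-th error is at most the
previous error, which is at most `α` for `k ≥ 1` but equals `1` for `k = 0`. -/
theorem exists_isConvergentPair {α : ℝ} (hα : Irrational α) (hα0 : 0 < α) (hα1 : α < 1 / 2)
    {k : ℕ} (hk : 1 ≤ k) : ∃ (a q Q : ℕ) (p P : ℤ), partQuot α (k + 1) = a ∧
      convDen α k = q ∧ convDen α (k + 1) = Q ∧ IsConvergentPair α a q Q p P := by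
  obtain ⟨x, p', q', p, q, h, hx⟩ := exists_convergentState hα hα0 hα1 k
  have h2 := h.succ hα0 hα1 hx
  obtain ⟨a, ha⟩ := Int.eq_ofNat_of_zero_le (zero_le_one.trans h.quot_pos)
  obtain ⟨r, rfl⟩ := Int.eq_ofNat_of_zero_le (zero_le_one.trans h.one_le)
  obtain ⟨R, hR⟩ := Int.eq_ofNat_of_zero_le (zero_le_one.trans h2.one_le)
  rw [hR] at h2
  have hne : (r : ℝ) * α - p ≠ 0 := by
    intro h0
    have : (r : ℝ) ≠ 0 := by
      have := h.one_le
      intro h'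
      have : r = 0 := by exact_mod_cast h'
      omega
    exact ((hα.natCast_mul (m := r) (by exact_mod_cast this)).sub_intCast p).ne_zero h0
  have herr := h2.error
  push_cast at herr
  refine ⟨a, r, R, p, _, ?_, ?_, ?_, ?_, ?_, h2.det, ?_, ?_, ?_, ?_⟩
  · rw [h.partQuot_eq, ha]; rfl
  · rw [h.convDen_eq]; rfl
  · rw [h2.convDen_eq]; rfl
  · have := h.quot_pos
    rw [ha] at this
    exact_mod_cast this
  · exact_mod_cast h.two_le hk
  · zify
    rw [← hR, ha]
    linarith [h.prev_nonneg]
  · push_cast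
    rw [herr]
    nlinarith [mul_pos h2.pos (mul_self_pos.2 hne)]
  · push_cast
    rw [herr, abs_mul, abs_neg, abs_of_pos h2.pos]
    exact mul_lt_of_lt_one_left (abs_pos.2 hne) h2.lt_one
  · have e := h.error
    push_cast at e
    rw [e, abs_mul, abs_neg, abs_of_pos h.pos, ← mul_assoc]
    have hax : (a : ℝ) * x ≤ 1 := by
      have h3 : ((⌊x⁻¹⌋ : ℤ) : ℝ) ≤ x⁻¹ := Int.floor_le _
      rw [ha] at h3
      push_cast at h3
      calc (a : ℝ) * x ≤ x⁻¹ * x := mul_le_mul_of_nonneg_right h3 h.pos.le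
        _ = 1 := inv_mul_cancel₀ h.pos.ne'
    exact (mul_le_of_le_one_left (abs_nonneg _) hax).trans (h.prev_error_le hk)

/-- If `k = 0`, then `m < q_1 = a_1`, and `m = m q_0` would lie in `M_α`. -/
theorem one_le_of_not_mem_multSet {α : ℝ} (hα : Irrational α) (hα0 : 0 < α) (hα1 : α < 1 / 2)
    {m k : ℕ} (hmM : m ∉ multSet α) (hk : IsGreatest {j : ℕ | convDen α j ≤ (m : ℝ)} k) :
    1 ≤ k := by
  have h0 := ConvergentState.zero hα hα0 hα1
  have h1 := h0.succ hα0 hα1 (fun _ => rfl)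
  by_contra hk0
  obtain rfl : k = 0 := by omega
  have hm1 : (1 : ℝ) ≤ m := by
    have := hk.1
    simpa [h0.convDen_eq] using this
  have hlt : (m : ℝ) < convDen α 1 := by
    by_contra hle
    have := hk.2 (not_lt.1 hle)
    omega
  refine hmM ⟨0, m, by exact_mod_cast hm1, ?_, by simp [h0.convDen_eq]⟩
  rw [h0.partQuot_eq]
  rw [h1.convDen_eq] at hlt
  simpa using hlt.le

/-! ### Exceptional positions of a balanced function -/

/-- `F` stays within distance `1` of a linear function of slope `α`, on every interval. -/
def IsBalanced (α : ℝ) (F : ℕ → ℤ) : Prop :=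
  ∀ i j : ℕ, |((F j - F i : ℤ) : ℝ) - ((j : ℝ) - i) * α| < 1

theorem IsConvergentPair.error_lt_one {α : ℝ} (hα1 : α < 1 / 2) {a q Q : ℕ} {p P : ℤ}
    (h : IsConvergentPair α a q Q p P) : |(q : ℝ) * α - p| < 1 := by
  have h1 : (1 : ℝ) ≤ a := by exact_mod_cast h.one_le
  nlinarith [h.error_le, abs_nonneg ((q : ℝ) * α - p)]

/-- Both exceptional increments deviate from `p` in the same direction. Balance between `i + q` and
`j` gives one side of the estimate, and balance between `i` and `j + q` the other. -/
theorem IsBalanced.abs_lt_of_ne {α : ℝ} (hα1 : α < 1 / 2) {a q Q : ℕ} {p P : ℤ}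
    (h : IsConvergentPair α a q Q p P) {F : ℕ → ℤ} (hF : IsBalanced α F) {i j : ℕ}
    (hi : F (i + q) - F i ≠ p) (hj : F (j + q) - F j ≠ p) :
    |((F j - F i : ℤ) : ℝ) - ((j : ℝ) - i) * α| < |(q : ℝ) * α - p| := by
  have hD := h.error_lt_one hα1
  have key : ∀ l, F (l + q) - F l ≠ p →
      (0 < (q : ℝ) * α - p ∧ F (l + q) - F l = p + 1) ∨
      ((q : ℝ) * α - p < 0 ∧ F (l + q) - F l = p - 1) := by
    intro l hl
    have hb := hF l (l + q)
    rw [abs_lt] at hb hD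
    push_cast at hb
    have u1 : ((F (l + q) - F l : ℤ) : ℝ) < ((p + 2 : ℤ) : ℝ) := by push_cast; linarith
    have u2 : ((p - 2 : ℤ) : ℝ) < ((F (l + q) - F l : ℤ) : ℝ) := by push_cast; linarith
    have u1' := Int.cast_lt.1 u1
    have u2' := Int.cast_lt.1 u2
    have : F (l + q) - F l = p + 1 ∨ F (l + q) - F l = p - 1 := by omega
    rcases this with e | e
    · left
      have e' : ((F (l + q) : ℤ) : ℝ) - F l = p + 1 := by exact_mod_cast e
      exact ⟨by linarith, e⟩
    · right
      have e' : ((F (l + q) : ℤ) : ℝ) - F l = p - 1 := by exact_mod_cast e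
      exact ⟨by linarith, e⟩
  have b1 := hF (i + q) j
  have b2 := hF i (j + q)
  rw [abs_lt] at b1 b2 ⊢
  push_cast at b1 b2 ⊢
  rcases key i hi with ⟨hp, ei⟩ | ⟨hn, ei⟩ <;> rcases key j hj with ⟨hp', ej⟩ | ⟨hn', ej⟩
  · have ei' : ((F (i + q) : ℤ) : ℝ) - F i = p + 1 := by exact_mod_cast ei
    have ej' : ((F (j + q) : ℤ) : ℝ) - F j = p + 1 := by exact_mod_cast ej
    rw [abs_of_pos hp]
    constructor <;> linarith
  · linarith
  · linarith
  · have ei' : ((F (i + q) : ℤ) : ℝ) - F i = p - 1 := by exact_mod_cast ei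
    have ej' : ((F (j + q) : ℤ) : ℝ) - F j = p - 1 := by exact_mod_cast ej
    rw [abs_of_neg hn]
    constructor <;> linarith

/-- The difference of two positions where the increment over `q` steps is exceptional is
`s Q + u q`, where `s` is additive in the positions. -/
theorem IsBalanced.exists_eq_add {α : ℝ} (hα1 : α < 1 / 2) {a q Q : ℕ} {p P : ℤ}
    (h : IsConvergentPair α a q Q p P) {F : ℕ → ℤ} (hF : IsBalanced α F) {i j : ℕ} (hij : i ≤ j)
    (hi : F (i + q) - F i ≠ p) (hj : F (j + q) - F j ≠ p) :
    ∃ s u : ℕ, j = i + s * Q + u * q ∧ (i < j → 1 ≤ s) ∧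
      (s : ℤ) = (Q * p - q * P) * (p * j - q * F j) - (Q * p - q * P) * (p * i - q * F i) := by
  rcases hij.eq_or_lt with rfl | hlt
  · exact ⟨0, 0, by simp, by simp, by simp⟩
  have hb := hF.abs_lt_of_ne hα1 h hi hj
  have hdet2 : ((Q : ℤ) * p - q * P) ^ 2 = 1 := by
    rcases h.det with e | e <;> rw [e] <;> norm_num
  set η : ℤ := (Q : ℤ) * p - q * P with hη
  -- Cramer's rule: `s`, `u` are the coordinates of `(j - i, F j - F i)` in the basis `(Q, P)`, `(q,
  -- p)`, whose determinant is `η = ±1`.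
  set s : ℤ := η * (p * (j - i) - q * (F j - F i)) with hs
  set u : ℤ := η * (Q * (F j - F i) - P * (j - i)) with hu
  have e1 : (j : ℤ) - i = s * Q + u * q := by
    rw [hs, hu]; linear_combination (-((j : ℤ) - i)) * hdet2 + ((j : ℤ) - i) * η * hη
  have e2 : F j - F i = s * P + u * p := by
    rw [hs, hu]; linear_combination (-(F j - F i)) * hdet2 + (F j - F i) * η * hη
  have e1' : (j : ℝ) - i = s * Q + u * q := by exact_mod_cast e1
  have e2' : ((F j - F i : ℤ) : ℝ) = s * P + u * p := by exact_mod_cast e2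
  rw [e2', e1'] at hb
  set D : ℝ := (q : ℝ) * α - p with hD
  set D' : ℝ := (Q : ℝ) * α - P with hD'
  have hb2 : |(s : ℝ) * D' + u * D| < |D| := by
    rw [← abs_neg]
    convert hb using 2
    rw [hD, hD']; ring
  have hsign := h.sign
  rw [← hD, ← hD'] at hsign
  have hpos : 0 < s * (Q : ℤ) + u * q := by rw [← e1]; omega
  have hQ : (0 : ℤ) ≤ Q := by omega
  have hq : (0 : ℤ) ≤ q := by omega
  -- `D` and `D'` have opposite signs, so coefficients of opposite signs with `u ≠ 0` make `|s D' +
  -- u D|` at least `|D|`.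
  have hs1 : 1 ≤ s := by
    by_contra hs0
    have hs0' : s ≤ 0 := by omega
    have hu1 : 1 ≤ u := by
      by_contra hu0
      have : u ≤ 0 := by omega
      nlinarith
    have r1 : (s : ℝ) ≤ 0 := by exact_mod_cast hs0'
    have r2 : (1 : ℝ) ≤ u := by exact_mod_cast hu1
    rcases lt_or_ge 0 D with hDp | hDn
    · have : D' < 0 := by nlinarith
      rw [abs_of_pos hDp, abs_lt] at hb2
      nlinarith
    · have : 0 < D' := by nlinarith
      rw [abs_of_nonpos hDn, abs_lt] at hb2
      nlinarith
  have hu0 : 0 ≤ u := by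
    by_contra hu1
    have hu1' : u ≤ -1 := by omega
    have r1 : (1 : ℝ) ≤ s := by exact_mod_cast hs1
    have r2 : (u : ℝ) ≤ -1 := by exact_mod_cast hu1'
    rcases lt_or_ge 0 D with hDp | hDn
    · have : D' < 0 := by nlinarith
      rw [abs_of_pos hDp, abs_lt] at hb2
      nlinarith
    · have : 0 < D' := by nlinarith
      rw [abs_of_nonpos hDn, abs_lt] at hb2
      nlinarith
  obtain ⟨s', hs'⟩ := Int.eq_ofNat_of_zero_le (zero_le_one.trans hs1)
  obtain ⟨u', hu'⟩ := Int.eq_ofNat_of_zero_le hu0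
  refine ⟨s', u', ?_, fun _ => ?_, ?_⟩
  · rw [hs', hu'] at e1
    zify
    linarith
  · omega
  · rw [← hs', hs]; ring

/-! ### Decompositions from runs of regular blocks -/

theorem sub_eq_mul_of_forall {F : ℕ → ℤ} {H q E : ℕ} {p : ℤ}
    (hE : ∀ i < E, F (H + i * q + q) - F (H + i * q) = p) (n i : ℕ) (hi : i + n ≤ E) :
    F (H + (i + n) * q) - F (H + i * q) = n * p := by
  induction n with
  | zero => simp
  | succ n ih =>
    have h1 := ih (by omega)
    have h2 := hE (i + n) (by omega)
    have h3 : H + (i + (n + 1)) * q = H + (i + n) * q + q := by ring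
    rw [h3]
    push_cast
    linarith

/-- The interval `[0, L]` splits into a head, a tail and at least one block of length `n`,
where head and tail are shorter than `n` and `F` increases by `c` on every block. -/
def HasDecomp (F : ℕ → ℤ) (L n : ℕ) (c : ℤ) : Prop :=
  ∃ H b T : ℕ, 1 ≤ b ∧ H + b * n + T = L ∧ H < n ∧ T < n ∧
    ∀ i < b, F (H + i * n + n) - F (H + i * n) = c

/-- Regular blocks are grouped by `t`. The fewer than `t` left over are shared between head and
tail, and `x + y + 1 ≤ t` leaves enough room for them. -/
theorem hasDecomp_mul {F : ℕ → ℤ} {t q H E T L x y : ℕ} {p : ℤ} (hL : H + E * q + T = L)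
    (hH : H < (x + 1) * q) (hT : T < (y + 1) * q) (hxy : x + y + 1 ≤ t) (htE : t ≤ E)
    (hE : ∀ i < E, F (H + i * q + q) - F (H + i * q) = p) :
    HasDecomp F L (t * q) (t * p) := by
  have ht : 0 < t := by omega
  have hdm := Nat.div_add_mod E t
  have hr := Nat.mod_lt E ht
  have hb : 1 ≤ E / t := (Nat.one_le_div_iff ht).2 htE
  set b := E / t
  set r := E % t
  obtain ⟨e, f, hef, he, hf⟩ : ∃ e f, e + f = r ∧ x + e + 1 ≤ t ∧ y + f + 1 ≤ t := by
    rcases le_total r (t - 1 - x) with hle | hle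
    · exact ⟨r, 0, by omega, by omega, by omega⟩
    · exact ⟨t - 1 - x, r - (t - 1 - x), by omega, by omega, by omega⟩
  refine ⟨H + e * q, b, T + f * q, hb, ?_, ?_, ?_, fun i hi => ?_⟩
  · rw [← hL, ← hdm, ← hef]; ring
  · calc H + e * q < (x + 1) * q + e * q := by omega
      _ = (x + e + 1) * q := by ring
      _ ≤ t * q := Nat.mul_le_mul_right _ he
  · calc T + f * q < (y + 1) * q + f * q := by omega
      _ = (y + f + 1) * q := by ring
      _ ≤ t * q := Nat.mul_le_mul_right _ hf
  · have h1 := sub_eq_mul_of_forall hE t (e + i * t) (by nlinarith)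
    have e1 : H + e * q + i * (t * q) + t * q = H + (e + i * t + t) * q := by ring
    have e2 : H + e * q + i * (t * q) = H + (e + i * t) * q := by ring
    rw [e1, e2, h1]

theorem IsConvergentPair.coprime {α : ℝ} {a q Q : ℕ} {p P : ℤ}
    (h : IsConvergentPair α a q Q p P) : Nat.Coprime q Q := by
  rw [← Nat.isCoprime_iff_coprime]
  rcases h.det with e | e
  · exact ⟨-P, p, by linarith⟩
  · exact ⟨P, -p, by linarith⟩

/-- A residue class mod `q` without exceptional positions gives period `q`. If every class has one,
the coordinate `s` between the first and the last is `q - 1` or `q`, and the run in the class of one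
of them gives period `tq`. -/
theorem exists_hasDecomp {α : ℝ} (hα1 : α < 1 / 2) {a q Q : ℕ} {p P : ℤ}
    (h : IsConvergentPair α a q Q p P) {F : ℕ → ℤ} (hF : IsBalanced α F) {t L : ℕ} (ht : 1 ≤ t)
    (hta : t ≤ a) (hqL : q < L) (hL : L + Q + q < (Q + 2 * t) * q) :
    ∃ s, 1 ≤ s ∧ s ≤ t ∧ HasDecomp F L (s * q) (s * p) := by
  have hq2 := h.two_le
  have htQ : t * q ≤ Q := (Nat.mul_le_mul_right _ hta).trans h.mul_le
  have hqQ : q ≤ Q := (Nat.le_mul_of_pos_left _ ht).trans htQ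
  by_cases hL2 : L < 2 * q
  · have : ∃ H ≤ 1, F (H + q) - F H = p := by
      by_contra hcon
      push Not at hcon
      obtain ⟨s, u, e, hs, -⟩ :=
        hF.exists_eq_add hα1 h zero_le_one (hcon 0 zero_le_one) (hcon 1 le_rfl)
      have := hs zero_lt_one
      nlinarith
    obtain ⟨H, hH, hHp⟩ := this
    exact ⟨1, le_rfl, ht, hasDecomp_mul (H := H) (E := 1) (T := L - q - H) (x := 0) (y := 0)
      (by omega) (by omega) (by omega) le_rfl le_rfl (by
        intro i hi
        obtain rfl : i = 0 := by omega
        simpa using hHp)⟩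
  by_cases hfree : ∃ c < q, ∀ j, j % q = c → j + q ≤ L → F (j + q) - F j = p
  · obtain ⟨c, hc, hfree⟩ := hfree
    have hdm := Nat.div_add_mod (L - c) q
    have hm := Nat.mod_lt (L - c) (show 0 < q by omega)
    have hE : 1 ≤ (L - c) / q := (Nat.one_le_div_iff (by omega)).2 (by omega)
    rw [mul_comm] at hdm
    refine ⟨1, le_rfl, ht, hasDecomp_mul (H := c) (E := (L - c) / q) (T := (L - c) % q) (x := 0)
      (y := 0) (by omega) (by omega) (by omega) le_rfl hE fun i hi => hfree _ ?_ ?_⟩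
    · rw [Nat.add_mul_mod_self_right, Nat.mod_eq_of_lt hc]
    · have : (i + 1) * q ≤ (L - c) / q * q := Nat.mul_le_mul_right _ hi
      rw [add_mul] at this
      omega
  push Not at hfree
  set S := (Finset.range (L + 1)).filter (fun j => j + q ≤ L ∧ F (j + q) - F j ≠ p) with hS
  have memS : ∀ j, j ∈ S ↔ j + q ≤ L ∧ F (j + q) - F j ≠ p := by
    intro j
    simp only [hS, Finset.mem_filter, Finset.mem_range]
    constructor
    · exact fun h => h.2
    · exact fun h => ⟨by omega, h⟩
  have hne : S.Nonempty := by
    obtain ⟨j, -, hj⟩ := hfree 0 (by omega)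
    exact ⟨j, (memS j).2 hj⟩
  set j1 := S.min' hne
  set j2 := S.max' hne
  obtain ⟨hj1L, hj1⟩ := (memS j1).1 (S.min'_mem hne)
  obtain ⟨hj2L, hj2⟩ := (memS j2).1 (S.max'_mem hne)
  have hmin : ∀ j ∈ S, j1 ≤ j := fun j hj => S.min'_le j hj
  have hmax : ∀ j ∈ S, j ≤ j2 := fun j hj => S.le_max' j hj
  obtain ⟨s, u, e12, -, hs12⟩ := hF.exists_eq_add hα1 h (hmin _ (S.max'_mem hne)) hj1 hj2
  have hcop := h.coprime
  have split : ∀ j ∈ S, ∃ s1 s2 u1 u2 : ℕ, j = j1 + s1 * Q + u1 * q ∧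
      j2 = j + s2 * Q + u2 * q ∧ s1 + s2 = s ∧ (j1 < j → 1 ≤ s1) ∧ (j < j2 → 1 ≤ s2) := by
    intro j hj
    have hj' := ((memS j).1 hj).2
    obtain ⟨s1, u1, e1, h1, f1⟩ := hF.exists_eq_add hα1 h (hmin j hj) hj1 hj'
    obtain ⟨s2, u2, e2, h2, f2⟩ := hF.exists_eq_add hα1 h (hmax j hj) hj' hj2
    exact ⟨s1, s2, u1, u2, e1, e2, by zify; linarith, h1, h2⟩
  have dvd_of : ∀ i j s' u' x : ℕ, j = i + s' * Q + u' * q → j = i + x * q → q ∣ s' := by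
    intro i j s' u' x h1 h2
    have h3 : x * q = u' * q + s' * Q := by omega
    have h4 : q ∣ s' * Q := (Nat.dvd_add_right (Dvd.intro_left u' rfl)).1
      (h3 ▸ Dvd.intro_left x rfl)
    exact hcop.dvd_of_dvd_mul_right h4
  -- An exceptional position in the class of `j1 - Q` has coordinate `s1 ≡ -1` mod `q` relative to
  -- `j1`.
  have hs_ge : q ≤ s + 1 := by
    obtain ⟨j, hjc, hj⟩ := hfree ((j1 + (q - 1) * Q) % q) (Nat.mod_lt _ (by omega))
    obtain ⟨s1, s2, u1, u2, e1, -, hs, -⟩ := split j ((memS j).2 hj)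
    have hmod : (s1 + 1) * Q ≡ 0 [MOD q] := by
      have : j1 + s1 * Q + u1 * q ≡ j1 + (q - 1) * Q [MOD q] := by rw [← e1]; exact hjc
      have h5 : j1 + s1 * Q ≡ j1 + (q - 1) * Q [MOD q] := by
        simpa [Nat.ModEq] using this
      have h6 := (Nat.ModEq.add_left_cancel' _ h5).add_right Q
      have h7 : (q - 1) * Q + Q = q * Q := by
        obtain ⟨r, rfl⟩ : ∃ r, q = r + 1 := ⟨q - 1, by omega⟩
        simp; ring
      rw [h7] at h6
      calc (s1 + 1) * Q = s1 * Q + Q := by ring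
        _ ≡ q * Q [MOD q] := h6
        _ ≡ 0 [MOD q] := by simp [Nat.ModEq]
    have := Nat.le_of_dvd (by omega)
      (hcop.dvd_of_dvd_mul_right ((Nat.modEq_zero_iff_dvd).1 hmod))
    omega
  have hs_le : s ≤ q := by
    by_contra hlt
    have : (q + 1) * Q ≤ s * Q := Nat.mul_le_mul_right _ (by omega)
    nlinarith
  have hQt : Q * (q - 1) + Q = Q * q := by
    obtain ⟨r, rfl⟩ : ∃ r, q = r + 1 := ⟨q - 1, by omega⟩
    simp; ring
  have hle1 : Q ≤ Q * (q - 1) := Nat.le_mul_of_pos_right _ (by omega)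
  have hqpos : 0 < q := by omega
  have hsplitL : (Q + 2 * t) * q = Q * q + t * q + t * q := by ring
  have ht1 : t - 1 + 1 = t := by omega
  refine ⟨t, ht, le_rfl, ?_⟩
  rcases (show s = q - 1 ∨ s = q by omega) with hs | hs
  -- As `s < q`, the class of `j1` is regular after `j1` and that of `j2` before `j2`. The bound on
  -- `L` forces `j1 + q < tq` or `L - j2 < tq`, which decides the run to use.
  · have hsQ : s * Q = Q * (q - 1) := by rw [hs, mul_comm]
    by_cases hfirst : j1 + q < t * q
    · have hdm := Nat.div_add_mod (L - (j1 + q)) q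
      have hm := Nat.mod_lt (L - (j1 + q)) hqpos
      rw [mul_comm] at hdm
      refine hasDecomp_mul (H := j1 + q) (E := (L - (j1 + q)) / q) (T := (L - (j1 + q)) % q)
        (x := t - 1) (y := 0) (by omega) (by rwa [ht1]) (by omega) (by omega) ?_ ?_
      · rw [Nat.le_div_iff_mul_le hqpos]
        omega
      · intro i hi
        by_contra hodd
        have : (i + 1) * q ≤ (L - (j1 + q)) / q * q := Nat.mul_le_mul_right _ hi
        rw [add_mul] at this
        obtain ⟨s1, s2, u1, u2, e1, e2, hss, hs1, -⟩ :=
          split (j1 + q + i * q) ((memS _).2 ⟨by omega, hodd⟩)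
        have h1 := hs1 (by omega)
        have := Nat.le_of_dvd (by omega) (dvd_of _ _ _ _ (i + 1) e1 (by ring))
        omega
    · have hdm := Nat.div_add_mod j2 q
      have hm := Nat.mod_lt j2 hqpos
      rw [mul_comm] at hdm
      refine hasDecomp_mul (H := j2 % q) (E := j2 / q) (T := L - j2)
        (x := 0) (y := t - 1) (by omega) (by omega) (by rw [ht1]; omega) (by omega) ?_ ?_
      · rw [Nat.le_div_iff_mul_le hqpos]
        omega
      · intro i hi
        by_contra hodd
        obtain ⟨z, hz⟩ : ∃ z, j2 / q = i + 1 + z := ⟨j2 / q - (i + 1), by omega⟩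
        have hj2' : j2 = j2 % q + i * q + (1 + z) * q := by
          conv_lhs => rw [← hdm, hz]
          ring
        have : q ≤ (1 + z) * q := Nat.le_mul_of_pos_left _ (by omega)
        obtain ⟨s1, s2, u1, u2, e1, e2, hss, -, hs2⟩ :=
          split (j2 % q + i * q) ((memS _).2 ⟨by omega, hodd⟩)
        have h1 := hs2 (by omega)
        have := Nat.le_of_dvd (by omega) (dvd_of _ _ _ _ (1 + z) e2 hj2')
        omega
  -- Now `j1` and `j2` share a class, regular strictly between them: an exceptional position there
  -- would split `s = q` into two positive parts, the first divisible by `q`. Head and tail together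
  -- have fewer than `2tq - Q ≤ tq` letters.
  · have hsQ : s * Q = Q * q := by rw [hs, mul_comm]
    have e12' : j2 = j1 + (Q + u) * q := e12.trans (by rw [hsQ]; ring)
    have hd1 := Nat.div_add_mod (j1 + q) q
    have hd2 := Nat.div_add_mod (L - j2) q
    have hm1 := Nat.mod_lt (j1 + q) hqpos
    have hm2 := Nat.mod_lt (L - j2) hqpos
    have htq : t + 1 ≤ t * q := by
      by_cases ht' : t = 1
      · omega
      · nlinarith
    have hE : (Q + u - 1) * q + q = (Q + u) * q := by
      rw [← Nat.succ_mul, Nat.succ_eq_add_one, Nat.sub_add_cancel (by omega)]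
    refine hasDecomp_mul (H := j1 + q) (E := Q + u - 1) (T := L - j2)
        (x := (j1 + q) / q) (y := (L - j2) / q) (by omega) ?_ ?_ ?_ (by omega) ?_
    · rw [add_mul, mul_comm]; omega
    · rw [add_mul, mul_comm]; omega
    · have : ((j1 + q) / q + (L - j2) / q) * q < t * q := by
        rw [add_mul, mul_comm ((j1 + q) / q), mul_comm ((L - j2) / q)]
        have : (Q + u) * q = Q * q + u * q := by ring
        omega
      have := Nat.lt_of_mul_lt_mul_right this
      omega
    · intro i hi
      by_contra hodd
      have : (i + 1) * q ≤ (Q + u - 1) * q := Nat.mul_le_mul_right _ hi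
      rw [add_mul] at this
      obtain ⟨s1, s2, u1, u2, e1, e2, hss, hs1, hs2⟩ :=
        split (j1 + q + i * q) ((memS _).2 ⟨by omega, hodd⟩)
      have h1 := hs1 (by omega)
      have h2 := hs2 (by omega)
      have := Nat.le_of_dvd (by omega) (dvd_of _ _ _ _ (i + 1) e1 (by ring))
      omega

/-! ### Sturmian words as differences of balanced functions -/

theorem lowerWord_val {α : ℝ} (hα0 : 0 < α) (hα1 : α < 1) (ρ : ℝ) (n : ℕ) :
    ((lowerWord α ρ n).val : ℤ) = ⌊ρ + (n + 1 : ℕ) * α⌋ - ⌊ρ + n * α⌋ := by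
  have h1 := Int.floor_add_fract (ρ + n * α)
  have h2 := Int.fract_nonneg (ρ + n * α)
  have h3 := Int.fract_lt_one (ρ + n * α)
  unfold lowerWord
  split_ifs with h
  · have : ⌊ρ + (n + 1 : ℕ) * α⌋ = ⌊ρ + n * α⌋ := by
      rw [Int.floor_eq_iff]
      push_cast
      constructor <;> linarith
    rw [this]
    simp
  · have : ⌊ρ + (n + 1 : ℕ) * α⌋ = ⌊ρ + n * α⌋ + 1 := by
      rw [Int.floor_eq_iff]
      push_cast
      constructor <;> linarith
    rw [this]
    simp

theorem upperWord_val {α : ℝ} (hα0 : 0 < α) (hα1 : α < 1) (ρ : ℝ) (n : ℕ) :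
    ((upperWord α ρ n).val : ℤ) = ⌈ρ + (n + 1 : ℕ) * α⌉ - ⌈ρ + n * α⌉ := by
  have h1 := Int.floor_add_fract (ρ + n * α)
  have h2 := Int.fract_nonneg (ρ + n * α)
  have h3 := Int.fract_lt_one (ρ + n * α)
  unfold upperWord
  split_ifs with h
  · have e1 : ⌈ρ + n * α⌉ = ⌊ρ + n * α⌋ + 1 := by
      rw [Int.ceil_eq_iff]
      push_cast
      constructor <;> linarith [h.1]
    have e2 : ⌈ρ + (n + 1 : ℕ) * α⌉ = ⌊ρ + n * α⌋ + 1 := by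
      rw [Int.ceil_eq_iff]
      push_cast
      constructor <;> linarith [h.1, h.2]
    rw [e1, e2]
    simp
  · rw [not_and_or, not_lt, not_le] at h
    rcases h with h | h
    · have e1 : ⌈ρ + n * α⌉ = ⌊ρ + n * α⌋ := by
        rw [Int.ceil_eq_iff]
        constructor <;> linarith
      have e2 : ⌈ρ + (n + 1 : ℕ) * α⌉ = ⌊ρ + n * α⌋ + 1 := by
        rw [Int.ceil_eq_iff]
        push_cast
        constructor <;> linarith
      rw [e1, e2]
      simp
    · have e1 : ⌈ρ + n * α⌉ = ⌊ρ + n * α⌋ + 1 := by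
        rw [Int.ceil_eq_iff]
        push_cast
        constructor <;> linarith
      have e2 : ⌈ρ + (n + 1 : ℕ) * α⌉ = ⌊ρ + n * α⌋ + 2 := by
        rw [Int.ceil_eq_iff]
        push_cast
        constructor <;> linarith
      rw [e1, e2]
      simp only [Fin.isValue, Fin.val_one]
      push_cast
      ring

theorem exists_isBalanced_of_mem_subshift {α : ℝ} (hα0 : 0 < α) (hα1 : α < 1) {s : ℕ → Fin 2}
    (hs : s ∈ subshift α) :
    ∃ F : ℕ → ℤ, IsBalanced α F ∧ ∀ n, ((s n).val : ℤ) = F (n + 1) - F n := by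
  obtain ⟨ρ, -, rfl | rfl⟩ := hs
  · refine ⟨fun n => ⌊ρ + n * α⌋, fun i j => ?_, lowerWord_val hα0 hα1 ρ⟩
    have h1 := Int.floor_le (ρ + i * α)
    have h2 := Int.lt_floor_add_one (ρ + i * α)
    have h3 := Int.floor_le (ρ + j * α)
    have h4 := Int.lt_floor_add_one (ρ + j * α)
    rw [abs_lt]
    push_cast
    constructor <;> linarith
  · refine ⟨fun n => ⌈ρ + n * α⌉, fun i j => ?_, upperWord_val hα0 hα1 ρ⟩
    have h1 := Int.le_ceil (ρ + i * α)
    have h2 := Int.ceil_lt_add_one (ρ + i * α)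
    have h3 := Int.le_ceil (ρ + j * α)
    have h4 := Int.ceil_lt_add_one (ρ + j * α)
    rw [abs_lt]
    push_cast
    constructor <;> linarith

/-! ### Factors, Parikh vectors and abelian periods -/

/-- The word `s_i s_{i+1} ⋯ s_{i+n-1}`. -/
def factor (s : ℕ → Fin 2) (i n : ℕ) : Word :=
  (List.range n).map fun j => s (i + j)

@[simp] theorem length_factor (s : ℕ → Fin 2) (i n : ℕ) : (factor s i n).length = n := by
  simp [factor]

theorem factor_add (s : ℕ → Fin 2) (i n l : ℕ) :
    factor s i (n + l) = factor s i n ++ factor s (i + n) l := by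
  simp [factor, List.range_add, List.map_append, Function.comp_def, add_assoc]

theorem mem_lang_iff {α : ℝ} {w : Word} :
    w ∈ lang α ↔ ∃ s ∈ subshift α, ∃ i : ℕ, w = factor s i w.length := Iff.rfl

theorem factor_mem_lang {α : ℝ} {s : ℕ → Fin 2} (hs : s ∈ subshift α) (i n : ℕ) :
    factor s i n ∈ lang α :=
  ⟨s, hs, i, by simp [factor]⟩

theorem mem_lang_of_append {α : ℝ} {u v w : Word} (h : u ++ v ++ w ∈ lang α) : v ∈ lang α := by
  obtain ⟨s, hs, i, e⟩ := mem_lang_iff.1 h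
  rw [List.length_append, List.length_append, factor_add, factor_add] at e
  have h1 := List.append_inj_left e (by simp)
  have h2 := List.append_inj_right h1 (by simp)
  rw [h2]
  exact factor_mem_lang hs _ _

theorem count_one_factor {s : ℕ → Fin 2} {F : ℕ → ℤ}
    (hs : ∀ n, ((s n).val : ℤ) = F (n + 1) - F n) (i n : ℕ) :
    ((factor s i n).count 1 : ℤ) = F (i + n) - F i := by
  induction n with
  | zero => simp [factor]
  | succ n ih =>
    rw [factor_add, List.count_append]
    push_cast
    rw [ih]
    have h1 : ((factor s (i + n) 1).count 1 : ℤ) = (s (i + n)).val := by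
      have : factor s (i + n) 1 = [s (i + n)] := by simp [factor]
      rw [this]
      generalize s (i + n) = c
      fin_cases c <;> simp
    rw [h1, hs, ← add_assoc]
    ring

theorem count_zero_add_count_one (w : Word) : w.count 0 + w.count 1 = w.length := by
  induction w with
  | nil => rfl
  | cons c w ih =>
    rw [List.count_cons, List.count_cons, List.length_cons, ← ih]
    fin_cases c <;> simp <;> omega

theorem count_zero_factor {s : ℕ → Fin 2} {F : ℕ → ℤ}
    (hs : ∀ n, ((s n).val : ℤ) = F (n + 1) - F n) (i n : ℕ) :
    ((factor s i n).count 0 : ℤ) = n - (F (i + n) - F i) := by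
  have h1 := count_zero_add_count_one (factor s i n)
  rw [length_factor] at h1
  rw [← count_one_factor hs]
  omega

theorem flatten_factor (s : ℕ → Fin 2) (i n b : ℕ) :
    ((List.range b).map fun l => factor s (i + l * n) n).flatten = factor s i (b * n) := by
  induction b with
  | zero => simp [factor]
  | succ b ih => simp [List.range_succ, ih, Nat.succ_mul, factor_add]

theorem isAbelianDecomp_factor {s : ℕ → Fin 2} {F : ℕ → ℤ}
    (hs : ∀ n, ((s n).val : ℤ) = F (n + 1) - F n) {i H b n T : ℕ} {c : ℤ} (hb : 1 ≤ b)
    (hH : H < n) (hT : T < n)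
    (hblock : ∀ l < b, F (i + H + l * n + n) - F (i + H + l * n) = c)
    (hshort : ∀ j l, l < n → F (j + l) - F j ≤ c ∧ l - (F (j + l) - F j) ≤ n - c) :
    IsAbelianDecomp (factor s i (H + b * n + T)) (factor s i H)
      ((List.range b).map fun l => factor s (i + H + l * n) n)
      (factor s (i + H + b * n) T) n := by
  refine ⟨?_, ?_, ((n - c).toNat, c.toNat), ?_, ?_, ?_⟩
  · rw [flatten_factor, factor_add, factor_add, add_assoc]
  · simp; omega
  · simp only [List.mem_map, List.mem_range]
    rintro u ⟨l, hl, rfl⟩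
    refine ⟨by simp, ?_⟩
    have h0 := count_zero_factor hs (i + H + l * n) n
    have h1 := count_one_factor hs (i + H + l * n) n
    have := hblock l hl
    simp only [parikh, Prod.mk.injEq]
    omega
  all_goals
    refine lt_of_le_of_ne ?_ ?_
    · first
      | have h0 := count_zero_factor hs i H
        have h1 := count_one_factor hs i H
        have := hshort i H hH
        rw [parikh, Prod.mk_le_mk]
        omega
      | have h0 := count_zero_factor hs (i + H + b * n) T
        have h1 := count_one_factor hs (i + H + b * n) T
        have := hshort (i + H + b * n) T hT
        rw [parikh, Prod.mk_le_mk]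
        omega
    · intro e
      rw [parikh, Prod.mk.injEq] at e
      have h1 := count_zero_add_count_one (factor s i H)
      have h2 := count_zero_add_count_one (factor s (i + H + b * n) T)
      rw [length_factor] at h1 h2
      -- The empty factor gives `0 ≤ c ≤ n`, so `toNat` is harmless and equal Parikh vectors would
      -- force equal lengths.
      have := hshort i 0 (by omega)
      have := hblock 0 hb
      simp at this
      omega

/-- Factors shorter than `s q` contain at most as many `0`s and `1`s as `s` regular blocks. -/
theorem IsBalanced.short_le {α : ℝ} (hα0 : 0 < α) (hα1 : α < 1 / 2) {a q Q : ℕ} {p P : ℤ}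
    (h : IsConvergentPair α a q Q p P) {F : ℕ → ℤ} (hF : IsBalanced α F) {s : ℕ} (hs : s ≤ a)
    (j l : ℕ) (hl : l < s * q) :
    F (j + l) - F j ≤ s * p ∧ l - (F (j + l) - F j) ≤ (s * q : ℕ) - s * p := by
  have hb := hF j (j + l)
  rw [abs_lt] at hb
  push_cast at hb
  -- `s` regular blocks deviate from slope `α` by at most `α`, which the missing letter compensates
  -- when counting `1`s. For `0`s, an excess of `2α < 1` remains.
  have hsD : (s : ℝ) * |(q : ℝ) * α - p| ≤ α :=
    (mul_le_mul_of_nonneg_right (by exact_mod_cast hs) (abs_nonneg _)).trans h.error_le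
  have hl' : (l : ℝ) + 1 ≤ s * q := by exact_mod_cast hl
  have hs0 : (0 : ℝ) ≤ s := s.cast_nonneg
  have h1 : (s : ℝ) * (q * α - p) ≤ α :=
    (mul_le_mul_of_nonneg_left (le_abs_self _) hs0).trans hsD
  have h2 : -((s : ℝ) * (q * α - p)) ≤ α := by
    rw [← mul_neg]
    exact (mul_le_mul_of_nonneg_left (neg_le_abs _) hs0).trans hsD
  constructor
  · have : ((F (j + l) - F j : ℤ) : ℝ) < ((s * p + 1 : ℤ) : ℝ) := by
      push_cast
      nlinarith
    have := Int.cast_lt.1 this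
    omega
  · have : ((l - (F (j + l) - F j) : ℤ) : ℝ) < (((s * q : ℕ) - s * p + 1 : ℤ) : ℝ) := by
      push_cast
      nlinarith
    have := Int.cast_lt.1 this
    omega

theorem IsBalanced.shift {α : ℝ} {F : ℕ → ℤ} (hF : IsBalanced α F) (i : ℕ) :
    IsBalanced α fun j => F (i + j) := by
  intro j l
  have := hF (i + j) (i + l)
  push_cast at this ⊢
  convert this using 3
  ring

theorem exists_isAbelianPeriod {α : ℝ} (hα0 : 0 < α) (hα1 : α < 1 / 2) {a q Q : ℕ} {p P : ℤ}
    (h : IsConvergentPair α a q Q p P) {w : Word} (hw : w ∈ lang α) {t : ℕ} (ht : 1 ≤ t)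
    (hta : t ≤ a) (hqL : q < w.length) (hL : w.length + Q + q < (Q + 2 * t) * q) :
    ∃ s, 1 ≤ s ∧ s ≤ t ∧ IsAbelianPeriod w (s * q) := by
  obtain ⟨x, hx, i, e⟩ := mem_lang_iff.1 hw
  obtain ⟨F, hF, hxF⟩ := exists_isBalanced_of_mem_subshift hα0 (by linarith) hx
  obtain ⟨s, hs1, hst, H, b, T, hb, hlen, hH, hT, hblock⟩ :=
    exists_hasDecomp hα1 h (hF.shift i) ht hta hqL hL
  refine ⟨s, hs1, hst, factor x i H,
    (List.range b).map fun l => factor x (i + H + l * (s * q)) (s * q), factor x (i + H + b * (s * q)) T, ?_⟩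
  rw [e, ← hlen]
  refine isAbelianDecomp_factor hxF hb hH hT (c := s * p) (fun l hl => ?_)
    (hF.short_le hα0 hα1 h (hst.trans hta))
  simpa only [add_assoc] using hblock l hl

/-! ### Abelian powers and the maximum exponent -/

theorem length_flatten_of_forall {B : List Word} {m : ℕ} (h : ∀ u ∈ B, u.length = m) :
    B.flatten.length = B.length * m := by
  rw [List.length_flatten, List.map_congr_left h]
  simp

theorem count_flatten_of_forall {B : List Word} {c : Fin 2} {r : ℕ}
    (h : ∀ u ∈ B, u.count c = r) : B.flatten.count c = B.length * r := by
  rw [List.count_flatten, List.map_congr_left h]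
  simp

theorem length_lt_of_parikh_lt {u v : Word} (h : parikh u < parikh v) : u.length < v.length := by
  rw [← count_zero_add_count_one, ← count_zero_add_count_one]
  rw [parikh, parikh, Prod.mk_lt_mk] at h
  omega

/-- By balance, `e` blocks with `c` ones each satisfy `e |c - mα| < 1`, while `mα` has positive
distance to the integers. -/
theorem bddAbove_powerExponents {α : ℝ} (hα : Irrational α) (hα0 : 0 < α) (hα1 : α < 1 / 2)
    {m : ℕ} (hm : 1 ≤ m) : BddAbove (powerExponents α m) := by
  obtain ⟨N, hN⟩ : ∃ N : ℕ, ∀ c : ℤ, 1 ≤ N * |(c : ℝ) - m * α| := by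
    have hpos : 0 < |(m : ℝ) * α - round ((m : ℝ) * α)| :=
      abs_pos.2 ((hα.natCast_mul (m := m) (by omega)).sub_intCast _).ne_zero
    obtain ⟨N, hN⟩ := exists_nat_gt (|(m : ℝ) * α - round ((m : ℝ) * α)|)⁻¹
    refine ⟨N, fun c => ?_⟩
    have h1 := round_le ((m : ℝ) * α) c
    rw [abs_sub_comm (c : ℝ)]
    have h2 : 1 ≤ N * |(m : ℝ) * α - round ((m : ℝ) * α)| := by
      rw [inv_eq_one_div, div_lt_iff₀ hpos] at hN
      exact hN.le
    exact h2.trans (mul_le_mul_of_nonneg_left h1 N.cast_nonneg)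
  refine ⟨N, ?_⟩
  rintro e ⟨w, hw, -, B, rfl, rfl, -, R, hB, -, -⟩
  obtain ⟨s, hs, i, he⟩ := mem_lang_iff.1 hw
  obtain ⟨F, hF, hsF⟩ := exists_isBalanced_of_mem_subshift hα0 (by linarith) hs
  simp only [List.nil_append, List.append_nil] at he
  have hlen := length_flatten_of_forall fun u hu => (hB u hu).1
  have hcount := count_flatten_of_forall (c := 1) (r := R.2) fun u hu => by
    rw [← (hB u hu).2]; rfl
  have h1 := count_one_factor hsF i B.flatten.length
  rw [← he, hcount, hlen] at h1
  have hb := hF i (i + B.length * m)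
  rw [← h1] at hb
  push_cast at hb
  have e1 : (B.length : ℝ) * R.2 - (i + B.length * m - i) * α
      = B.length * ((R.2 : ℤ) - m * α) := by push_cast; ring
  rw [e1, abs_mul, Nat.abs_cast] at hb
  by_contra hlt
  have h3 : (N : ℝ) ≤ B.length := by exact_mod_cast (not_le.1 hlt).le
  have := mul_le_mul_of_nonneg_right h3 (abs_nonneg (((R.2 : ℤ) : ℝ) - m * α))
  linarith [hN R.2]

theorem two_mem_of_val_eq {α : ℝ} {s : ℕ → Fin 2} (hs : s ∈ subshift α) {F : ℕ → ℤ}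
    (hF : ∀ n, ((s n).val : ℤ) = F (n + 1) - F n) {m : ℕ} (hm : 1 ≤ m)
    (h : F (2 * m) - F m = F m - F 0) : 2 ∈ powerExponents α m := by
  have h0 := count_zero_factor hF 0 m
  have h1 := count_one_factor hF 0 m
  have h2 := count_zero_factor hF m m
  have h3 := count_one_factor hF m m
  have hm2 : m + m = 2 * m := by ring
  rw [zero_add] at h0 h1
  rw [hm2] at h2 h3
  have hpos : parikh [] < parikh (factor s 0 m) := by
    have h4 := count_zero_add_count_one (factor s 0 m)
    rw [length_factor] at h4
    simp only [parikh, Prod.mk_lt_mk, List.count_nil]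
    omega
  refine ⟨factor s 0 (2 * m), factor_mem_lang hs _ _, le_rfl, [factor s 0 m, factor s m m], rfl,
    ?_, by simp, parikh (factor s 0 m), ?_, hpos, hpos⟩
  · rw [← hm2, factor_add]; simp
  · intro u hu
    simp only [List.mem_cons, List.not_mem_nil, or_false] at hu
    rcases hu with rfl | rfl
    · simp
    · simp only [length_factor, parikh, Prod.mk.injEq, true_and]
      omega

/-- With intercept `0`, the first two blocks agree in the lower word if `{mα} < 1/2` and in the
upper word if `{mα} > 1/2`. -/
theorem two_mem_powerExponents {α : ℝ} (hα : Irrational α) (hα0 : 0 < α) (hα1 : α < 1 / 2)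
    {m : ℕ} (hm : 1 ≤ m) : 2 ∈ powerExponents α m := by
  have h1 := Int.floor_add_fract ((m : ℝ) * α)
  have h2 := Int.fract_nonneg ((m : ℝ) * α)
  have h3 := Int.fract_lt_one ((m : ℝ) * α)
  have h01 : (0 : ℝ) ∈ Set.Ico (0 : ℝ) 1 := by simp
  rcases lt_or_ge (Int.fract ((m : ℝ) * α)) (1 / 2) with h | h
  · refine two_mem_of_val_eq ⟨0, h01, Or.inl rfl⟩ (F := fun n => ⌊(0 : ℝ) + n * α⌋)
      (lowerWord_val hα0 (by linarith) 0) hm ?_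
    have : ⌊(0 : ℝ) + (2 * m : ℕ) * α⌋ = 2 * ⌊(m : ℝ) * α⌋ := by
      rw [Int.floor_eq_iff]
      push_cast
      constructor <;> linarith
    simp only [this]
    simp
    ring
  · have h' : Int.fract ((m : ℝ) * α) ≠ 1 / 2 := by
      intro h'
      refine (hα.natCast_mul (m := m) (by omega)) ⟨⌊(m : ℝ) * α⌋ + 1 / 2, ?_⟩
      push_cast
      linarith
    refine two_mem_of_val_eq ⟨0, h01, Or.inr rfl⟩ (F := fun n => ⌈(0 : ℝ) + n * α⌉)
      (upperWord_val hα0 (by linarith) 0) hm ?_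
    have h4 : 1 / 2 < Int.fract ((m : ℝ) * α) := lt_of_le_of_ne h (Ne.symm h')
    have e1 : ⌈(0 : ℝ) + (2 * m : ℕ) * α⌉ = 2 * ⌊(m : ℝ) * α⌋ + 2 := by
      rw [Int.ceil_eq_iff]
      push_cast
      constructor <;> linarith
    have e2 : ⌈(m : ℝ) * α⌉ = ⌊(m : ℝ) * α⌋ + 1 := by
      rw [Int.ceil_eq_iff]
      push_cast
      constructor <;> linarith
    simp only [e1]
    simp [e2]
    ring

theorem isGreatest_abexp {α : ℝ} (hα : Irrational α) (hα0 : 0 < α) (hα1 : α < 1 / 2)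
    {m : ℕ} (hm : 1 ≤ m) : IsGreatest (powerExponents α m) (abexp α m) :=
  ⟨Nat.sSup_mem ⟨2, two_mem_powerExponents hα hα0 hα1 hm⟩ (bddAbove_powerExponents hα hα0 hα1 hm),
    fun _ he => le_csSup (bddAbove_powerExponents hα hα0 hα1 hm) he⟩

theorem length_bounds_of_isAbelianPeriod {α : ℝ} {w : Word} (hw : w ∈ lang α) {m e : ℕ}
    (hm : 1 ≤ m) (h : IsAbelianPeriod w m) (he : e ∈ upperBounds (powerExponents α m))
    (he2 : 2 ≤ e) : m ≤ w.length ∧ w.length + 2 ≤ (e + 2) * m := by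
  obtain ⟨u, B, v, rfl, hne, R, hB, hu, hv⟩ := h
  have hlen := length_flatten_of_forall fun u hu => (hB u hu).1
  obtain ⟨b, hb⟩ := List.exists_mem_of_ne_nil B hne
  have hbp := (hB b hb).2
  rw [← hbp] at hu hv
  have h1 := length_lt_of_parikh_lt hu
  have h2 := length_lt_of_parikh_lt hv
  rw [(hB b hb).1] at h1 h2
  have hB1 : 1 ≤ B.length := List.length_pos_iff.2 hne
  -- A single block is not an abelian power, so that case needs `2 ≤ e`.
  have hBe : B.length ≤ e := by
    rcases lt_or_ge B.length 2 with hlt | hge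
    · omega
    · have hnil : parikh [] < R := by
        rw [← hbp]
        have h4 := count_zero_add_count_one b
        rw [(hB b hb).1] at h4
        simp only [parikh, Prod.mk_lt_mk, List.count_nil]
        omega
      exact he ⟨B.flatten, mem_lang_of_append hw, hge, B, rfl, by simp, hne, R, hB, hnil, hnil⟩
  simp only [List.length_append, hlen]
  constructor <;> nlinarith

end Sturmian

/-! ### The length bounds -/

theorem mainTheorem6 (α : ℝ) (hα : Irrational α) (hα0 : 0 < α) (hα1 : α < 1 / 2)
    (w : Sturmian.Word) (hw : w ∈ Sturmian.lang α)
    (m : ℕ) (hm : Sturmian.IsMinAbelianPeriod w m) (hmM : m ∉ Sturmian.multSet α)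
    (k : ℕ) (hk : IsGreatest {j : ℕ | Sturmian.convDen α j ≤ (m : ℝ)} k)
    (t : ℕ) (ht : IsGreatest {s : ℕ | 1 ≤ s ∧ (s : ℝ) ≤ Sturmian.partQuot α (k + 1) ∧
      (s : ℝ) * Sturmian.convDen α k ≤ (m : ℝ)} t) :
    (Sturmian.convDen α (k + 1) + 2 * (t : ℝ) - 1) * Sturmian.convDen α k
        - Sturmian.convDen α (k + 1) ≤ (w.length : ℝ) ∧
    IsGreatest (Sturmian.powerExponents α m) (Sturmian.abexp α m) ∧
    (Sturmian.convDen α (k + 1) + 2 * (t : ℝ) - 1) * Sturmian.convDen α k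
        - Sturmian.convDen α (k + 1) ≤ ((Sturmian.abexp α m : ℝ) + 2) * (m : ℝ) - 2 := by
  obtain ⟨a, q, Q, p, P, ha, hq, hQ, hpair⟩ := Sturmian.exists_isConvergentPair hα hα0 hα1
    (Sturmian.one_le_of_not_mem_multSet hα hα0 hα1 hmM hk)
  obtain ⟨ht1, hta, htm⟩ := ht.1
  rw [ha] at hta
  rw [hq] at htm
  have hta' : t ≤ a := by exact_mod_cast hta
  have htm' : t * q ≤ m := by exact_mod_cast htm
  have hlt : ∀ s, 1 ≤ s → s ≤ t → s * q < m := by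
    intro s hs1 hst
    refine lt_of_le_of_ne ((Nat.mul_le_mul_right _ hst).trans htm') fun e => hmM
      ⟨k, s, hs1, ?_, ?_⟩
    · rw [ha]; exact_mod_cast hst.trans hta'
    · rw [hq, ← e]; push_cast; rfl
  have hqm : q < m := by simpa using hlt 1 le_rfl ht1
  have hm1 : 1 ≤ m := by omega
  have hmax := Sturmian.isGreatest_abexp hα hα0 hα1 hm1
  obtain ⟨hmL, hLe⟩ := Sturmian.length_bounds_of_isAbelianPeriod hw hm1 hm.1 hmax.2
    (hmax.2 (Sturmian.two_mem_powerExponents hα hα0 hα1 hm1))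
  have hmain : (Q + 2 * t) * q ≤ w.length + Q + q := by
    by_contra hcon
    obtain ⟨s, hs1, hst, hs⟩ := Sturmian.exists_isAbelianPeriod hα0 hα1 hpair hw ht1 hta'
      (hqm.trans_le hmL) (not_le.1 hcon)
    exact absurd (hm.2 hs) (not_le.2 (hlt s hs1 hst))
  have hmain' : ((Q : ℝ) + 2 * t) * q ≤ w.length + Q + q := by exact_mod_cast hmain
  have hLe' : (w.length : ℝ) + 2 ≤ (Sturmian.abexp α m + 2) * m := by exact_mod_cast hLe
  rw [hq, hQ]
  exact ⟨by linarith, hmax, by linarith⟩
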